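/- Let $p$ be an odd prime, let $g\ge 1$ be an integer, and let $K$ be a field of characteristic $p$. For indeterminates $z_1,\dots,z_{2g-1}$ over $\mathbb{F}_p$ let $c_k\in\mathbb{F}_p[z_1,\dots,z_{2g-1}]$ be the coefficient of $x^k$ in $\bigl(x(x-1)(x-z_1)(x-z_2)\cdots(x-z_{2g-1})\bigr)^{(p-1)/2}$ (with $c_k=0$ for $k<0$). Let $(\lambda_1,\dots,\lambda_{2g-1})\in K^{2g-1}$ be a common zero of all the polynomials $c_{ip-j}$ with $1\le i,j\le g$, i.e. a point at which the Cartier–Manin matrix $(c_{ip-j})_{1\le i,j\le g}$ vanishes. Then $0,1,\lambda_1,\dots,\lambda_{2g-1}$ are pairwise distinct, and the curve $$y^2=x(x-1)(x-\lambda_1)(x-\lambda_2)\cdots(x-\lambda_{2g-1})$$ is nonsingular: writing $f(x)$ for the right-hand side, neither the affine curve $y^2=f(x)$ nor its chart at infinity $v^2=u^{2g+2}f(1/u)$ (where $u=1/x$, $v=y/x^{g+1}$) has a singular point over an algebraic closure of $K$. -/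

import Mathlib

noncomputable section

/-- The polynomial `x (x - 1) ∏ₖ (x - zₖ)` in the variable `x`, with coefficients in `R`. -/
def rosenhainPoly {R ι : Type*} [CommRing R] [Fintype ι] (z : ι → R) : Polynomial R :=
  Polynomial.X * (Polynomial.X - 1) * ∏ k, (Polynomial.X - Polynomial.C (z k))

/-- The coefficient `c_k` of `x ^ k` in `f(x) ^ ((p - 1) / 2)`, where
`f(x) = x (x - 1) (x - z_1) ⋯ (x - z_{2g-1})` and the `z_i` are indeterminates over `𝔽_p`.
The index `k` is an integer, and `c_k = 0` for negative `k`. -/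
def cmCoeff (p g : ℕ) (k : ℤ) : MvPolynomial (Fin (2 * g - 1)) (ZMod p) :=
  if 0 ≤ k then
    (rosenhainPoly (fun i : Fin (2 * g - 1) =>
      (MvPolynomial.X i : MvPolynomial (Fin (2 * g - 1)) (ZMod p))) ^ ((p - 1) / 2)).coeff k.toNat
  else 0

/-- The affine plane curve `F = 0` over `K` is nonsingular: at every geometric point of it
some first partial derivative of `F` is nonzero. -/
def IsNonsingularPlaneCurve {K : Type*} [Field K] (F : MvPolynomial (Fin 2) K) : Prop :=
  ∀ P : Fin 2 → AlgebraicClosure K, MvPolynomial.aeval P F = 0 →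
    ∃ i, MvPolynomial.aeval P (MvPolynomial.pderiv i F) ≠ 0

/-- The polynomial `y ^ 2 - f(x)` in the two variables `x` (index `0`) and `y` (index `1`). -/
def doubleCoverPoly {K : Type*} [Field K] (f : Polynomial K) : MvPolynomial (Fin 2) K :=
  MvPolynomial.X 1 ^ 2 - Polynomial.aeval (MvPolynomial.X 0 : MvPolynomial (Fin 2) K) f

/-- The curve `y ^ 2 = f(x)`, with `deg f = 2g + 1`, is nonsingular, both in the affine plane and
in its standard chart around infinity `v ^ 2 = u ^ (2g + 2) f(1 / u)`
(`u = 1 / x`, `v = y / x ^ (g + 1)`). -/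
def IsNonsingularHyperelliptic {K : Type*} [Field K] (g : ℕ) (f : Polynomial K) : Prop :=
  IsNonsingularPlaneCurve (doubleCoverPoly f) ∧
    IsNonsingularPlaneCurve (doubleCoverPoly (Polynomial.reflect (2 * g + 2) f))

end

/-! Write M = (p - 1) / 2. The matrix vanishes only if D^(p-1) kills h f^M whenever deg h < g
(`cartierVanishes_of_coeff_eq_zero`). `CartierVanishes.separable` deduces, by induction on g, that f
is separable unless it is a power of a linear polynomial. A multiple root moved to 0 gives f = X^2
r, so f^M = X^(p-1) r^M. Taking h divisible by X shows that r inherits the condition for g - 1,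
hence is separable; taking h = X^l makes the coefficients of r^M in degrees kp - l vanish for l < g,
so in particular r(0) = 0. `exists_coeff_pow_ne_zero_of_separable` excludes this: for suitable B, H
= r^M B(x^p) solves r H' = M r' H and has a gap in its coefficients, so it splits into two solutions
A + x^(np) Q. Divisibility by r^M forces Q = 0, and then H = A has too small a degree. -/

open Polynomial

/-! ### Polynomials in characteristic p -/

/-- In characteristic `p`, the `(p - 1)`-st derivative of `F` vanishes iff the coefficients of `F`
in degrees congruent to `-1` modulo `p` vanish. -/
theorem iterate_derivative_pred_char_eq_zero_iff {K : Type*} [Field K] {p : ℕ} [Fact p.Prime]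
    [CharP K p] (F : K[X]) :
    derivative^[p - 1] F = 0 ↔ ∀ k, F.coeff (k * p + (p - 1)) = 0 := by
  have hp : p.Prime := Fact.out
  have hp1 := hp.one_lt
  constructor
  · intro h k
    have h1 := congrArg (fun G => coeff G (k * p)) h
    simp only [coeff_iterate_derivative, coeff_zero, nsmul_eq_mul, mul_eq_zero] at h1
    refine h1.resolve_left fun h2 => ?_
    rw [CharP.cast_eq_zero_iff K p, Nat.add_descFactorial_eq_ascFactorial,
      Nat.ascFactorial_eq_prod_range, hp.prime.dvd_finsetProd_iff] at h2
    obtain ⟨i, hi, hd⟩ := h2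
    rw [Finset.mem_range] at hi
    rw [add_assoc, Nat.dvd_add_right (Dvd.intro_left k rfl)] at hd
    have := Nat.le_of_dvd (by omega) hd
    omega
  · intro h
    ext m
    rw [coeff_iterate_derivative, coeff_zero, nsmul_eq_mul]
    by_cases hm : p ∣ m
    · obtain ⟨k, rfl⟩ := hm
      rw [mul_comm p k, h, mul_zero]
    · have h2 : p ∣ (m + (p - 1)).descFactorial (p - 1) := by
        rw [Nat.add_descFactorial_eq_ascFactorial, Nat.ascFactorial_eq_prod_range,
          hp.prime.dvd_finsetProd_iff]
        have h3 : m % p ≠ 0 := fun h => hm (Nat.dvd_of_mod_eq_zero h)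
        have h4 : m % p < p := Nat.mod_lt _ hp.pos
        -- The factor m + 1 + i that is the next multiple of p after m.
        refine ⟨p - m % p - 1, Finset.mem_range.2 (by omega), m / p + 1, ?_⟩
        have h5 := Nat.div_add_mod m p
        rw [mul_add, mul_one]
        omega
      rw [(CharP.cast_eq_zero_iff K p _).2 h2, zero_mul]

/-- Coefficients of a product with an expanded polynomial, when the relevant coefficients of the
first factor vanish. -/
theorem coeff_mul_expand_eq_zero {K : Type*} [Field K] {p : ℕ} [Fact p.Prime]
    {P : K[X]} (hP : ∀ k, P.coeff (k * p) = 0) (B : K[X]) (n : ℕ) :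
    (P * expand K p B).coeff (n * p) = 0 := by
  have hp : p.Prime := Fact.out
  induction B using Polynomial.induction_on' with
  | add a b ha hb => rw [map_add, mul_add, coeff_add, ha, hb, add_zero]
  | monomial m a =>
    rw [expand_monomial, ← C_mul_X_pow_eq_monomial, ← mul_assoc, coeff_mul_X_pow']
    split_ifs with h
    · rw [coeff_mul_C, ← Nat.sub_mul, hP, zero_mul]
    · rfl

/-- A polynomial solution of `r Q' = M r' Q` with `r` separable and `M < p` is divisible by
`r ^ M`. -/
theorem pow_dvd_of_mul_derivative_eq {K : Type*} [Field K] {p : ℕ} [CharP K p]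
    {r Q : K[X]} (hr : r.Separable) {M : ℕ} (hM : M < p)
    (h : r * derivative Q = M * derivative r * Q) : r ^ M ∣ Q := by
  have key : ∀ t, t ≤ M → r ^ t ∣ Q := by
    intro t
    induction t with
    | zero => simp
    | succ t ih =>
      intro ht
      obtain ⟨R, rfl⟩ := ih (by omega)
      have hr0 : r ≠ 0 := hr.ne_zero
      -- Cancelling r^t leaves the same equation with M - t, which is nonzero in K since 0 < M - t <
      -- p.
      have h1 : r * derivative R = ((M - t : ℕ) : K[X]) * derivative r * R := by
        apply mul_left_cancel₀ (pow_ne_zero t hr0)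
        rw [derivative_mul, derivative_pow] at h
        rw [Nat.cast_sub (by omega)]
        rcases t with _ | t
        · simpa using h
        · simp only [Nat.add_sub_cancel, map_natCast] at h
          linear_combination h
      have hc : ((M - t : ℕ) : K) ≠ 0 := by
        rw [Ne, CharP.cast_eq_zero_iff K p]
        intro hd
        have := Nat.le_of_dvd (by omega) hd
        omega
      have h2 : r ∣ C ((M - t : ℕ) : K) * (derivative r * R) := by
        refine ⟨derivative R, ?_⟩
        rw [h1, map_natCast, mul_assoc]
      have h3 : r ∣ derivative r * R := by
        rwa [(isUnit_C.2 hc.isUnit).dvd_mul_left] at h2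
      obtain ⟨S, hS⟩ := IsCoprime.dvd_of_dvd_mul_left hr h3
      exact ⟨S, by rw [hS, pow_succ]; ring⟩
  exact key M le_rfl

/-- A space of polynomials of degree less than `n` carries, for any `n - 1` linear functionals, a
nonzero common zero. -/
theorem exists_ne_zero_degree_lt_of_functionals {K : Type*} [Field K] {n : ℕ} (hn : 1 ≤ n)
    (φ : Fin (n - 1) → K[X] →ₗ[K] K) :
    ∃ B : K[X], B ≠ 0 ∧ B.natDegree < n ∧ ∀ i, φ i B = 0 := by
  let ψ : degreeLT K n →ₗ[K] (Fin (n - 1) → K) := (LinearMap.pi φ).comp (degreeLT K n).subtype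
  have e : Module.finrank K (degreeLT K n) = n := by
    rw [(degreeLTEquiv K n).finrank_eq, Module.finrank_fin_fun]
  have : FiniteDimensional K (degreeLT K n) :=
    Module.Finite.equiv (degreeLTEquiv K n).symm
  have hker : LinearMap.ker ψ ≠ ⊥ := by
    apply LinearMap.ker_ne_bot_of_finrank_lt
    rw [e, Module.finrank_fin_fun]
    omega
  obtain ⟨⟨B, hB⟩, hB1, hB2⟩ := Submodule.exists_mem_ne_zero_of_ne_bot hker
  have hB0 : B ≠ 0 := fun h => hB2 (Subtype.ext h)
  refine ⟨B, hB0, ?_, fun i => congrFun (LinearMap.mem_ker.1 hB1) i⟩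
  rw [mem_degreeLT] at hB
  exact (natDegree_lt_iff_degree_lt hB0).2 hB

/-! ### The nonvanishing coefficient -/

/-- For separable monic `r` of degree `2n + 1` with `r(0) = 0`, the coefficients of
`r ^ ((p - 1) / 2)` in degrees `kp - l` with `l ≤ n` cannot all vanish. -/
theorem exists_coeff_pow_ne_zero_of_separable {K : Type*} [Field K] {p : ℕ} [Fact p.Prime]
    [CharP K p] (hp2 : p ≠ 2) {n : ℕ} (hn : 1 ≤ n) {r : K[X]}
    (hr : r.Monic) (hdeg : r.natDegree = 2 * n + 1) (hsep : r.Separable) (h0 : r.coeff 0 = 0) :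
    ∃ l ≤ n, ∃ k, (X ^ l * r ^ ((p - 1) / 2)).coeff (k * p) ≠ 0 := by
  by_contra! hco
  have hp : p.Prime := Fact.out
  obtain ⟨M, hM⟩ : ∃ M, p = 2 * M + 1 := hp.odd_of_ne_two hp2
  have hM2 : (p - 1) / 2 = M := by omega
  rw [hM2] at hco
  have hrM : (r ^ M).Monic := hr.pow M
  have hdM : (r ^ M).natDegree = M * (2 * n + 1) := by rw [hr.natDegree_pow, hdeg]
  have hnp : n * p = 2 * n * M + n := by rw [hM]; ring
  have hMn : M * (2 * n + 1) = 2 * n * M + M := by ring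
  -- Otherwise l = n - M is allowed, and degree np picks out the leading coefficient of r^M.
  have hnM : n < M := by
    by_contra! hle
    have h1 := hco (n - M) (by omega) n
    have h2 : n * p = M * (2 * n + 1) + (n - M) := by omega
    rw [h2, mul_comm, coeff_mul_X_pow, ← hdM, hrM.coeff_natDegree] at h1
    exact one_ne_zero h1
  have hMp : M < p := by omega
  -- Shifts l ≤ n are free by `hco`; the n - 1 remaining shifts n < l < 2n are imposed on the n
  -- coefficients of B.
  let φ : Fin (n - 1) → K[X] →ₗ[K] K := fun i =>
    (lcoeff K (n * p)).comp ((LinearMap.mulLeft K (X ^ (n + 1 + (i : ℕ)) * r ^ M)).comp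
      (expand K p).toLinearMap)
  obtain ⟨B, hB0, hBn, hB⟩ := exists_ne_zero_degree_lt_of_functionals hn φ
  set H := r ^ M * expand K p B with hH
  have hHl : ∀ l < 2 * n, (X ^ l * H).coeff (n * p) = 0 := by
    intro l hl
    rw [hH, ← mul_assoc]
    by_cases hln : l ≤ n
    · exact coeff_mul_expand_eq_zero (hco l hln) B n
    · have := hB ⟨l - (n + 1), by omega⟩
      simpa only [φ, LinearMap.comp_apply, lcoeff_apply, LinearMap.mulLeft_apply,
        AlgHom.toLinearMap_apply, show n + 1 + (l - (n + 1)) = l by omega] using this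
  have hpK : (p : K[X]) = 0 := CharP.cast_eq_zero K[X] p
  have hE0 : expand K p B ≠ 0 := (expand_ne_zero hp.pos).2 hB0
  have hHd : H.natDegree = M * (2 * n + 1) + B.natDegree * p := by
    rw [hH, natDegree_mul hrM.ne_zero hE0, hdM, natDegree_expand]
  have hLH : r * derivative H = M * derivative r * H := by
    have hM1 : M = M - 1 + 1 := by omega
    have : r ^ M = r ^ (M - 1) * r := by rw [← pow_succ, ← hM1]
    rw [hH, derivative_mul, derivative_expand, derivative_pow, hpK, this]
    simp only [map_natCast]
    ring
  set N := n * p with hN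
  set A := H %ₘ (X ^ N) with hA
  set Q := H /ₘ (X ^ N) with hQ
  have hsplit : A + X ^ N * Q = H := modByMonic_add_div H _
  have hAdeg : A.degree < N := by
    have := degree_modByMonic_lt H (monic_X_pow (R := K) N)
    rwa [degree_X_pow] at this
  have hcoA : ∀ m < N, A.coeff m = H.coeff m := by
    intro m hm
    rw [← hsplit, coeff_add, mul_comm, coeff_mul_X_pow', if_neg (by omega), add_zero]
  have hN2 : 2 * n ≤ N := by
    rw [hnp]; nlinarith
  have hHc : ∀ l < 2 * n, H.coeff (N - l) = 0 := by
    intro l hl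
    have := hHl l hl
    rwa [mul_comm, coeff_mul_X_pow', if_pos (by omega)] at this
  have hAd : A.natDegree ≤ N - 2 * n := by
    rw [natDegree_le_iff_coeff_eq_zero]
    intro m hm
    by_cases hmN : m < N
    · rw [hcoA m hmN]
      have := hHc (N - m) (by omega)
      rwa [show N - (N - m) = m by omega] at this
    · exact coeff_eq_zero_of_degree_lt (hAdeg.trans_le (by exact_mod_cast not_lt.1 hmN))
  have hQ0 : Q.coeff 0 = 0 := by
    have h1 := hHc 0 (by omega)
    rw [← hsplit, coeff_add, mul_comm, Nat.sub_zero] at h1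
    rw [coeff_eq_zero_of_degree_lt hAdeg] at h1
    have h2 := coeff_mul_X_pow Q N 0
    rw [zero_add] at h2
    rwa [zero_add, h2] at h1
  have hDX : derivative (X ^ N : K[X]) = 0 := by
    rw [derivative_X_pow, hN, Nat.cast_mul, CharP.cast_eq_zero K p, mul_zero, map_zero, zero_mul]
  -- The operator L = r D - M r' commutes with X^N because p divides N, so LA = -X^N LQ.
  have hsum : r * derivative A - (M : K[X]) * derivative r * A
      = - (X ^ N * (r * derivative Q - (M : K[X]) * derivative r * Q)) := by
    rw [← hsplit, derivative_add, derivative_mul, hDX] at hLH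
    linear_combination hLH
  -- LA has degree at most N, while r(0) = Q(0) = 0 makes X^N LQ divisible by X^(N+1); both vanish.
  have hLQ : r * derivative Q - (M : K[X]) * derivative r * Q = 0 := by
    obtain ⟨r₁, hr₁⟩ := X_dvd_iff.2 h0
    obtain ⟨Q₁, hQ₁⟩ := X_dvd_iff.2 hQ0
    have hX : X ∣ r * derivative Q - (M : K[X]) * derivative r * Q := by
      refine dvd_sub ?_ ?_
      · rw [hr₁, mul_assoc]; exact dvd_mul_right _ _
      · rw [hQ₁]; exact Dvd.intro_left (M * derivative r * Q₁) (by ring)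
    obtain ⟨S, hS⟩ := hX
    have hle : (r * derivative A - (M : K[X]) * derivative r * A).natDegree ≤ N := by
      refine (natDegree_sub_le _ _).trans (max_le ?_ ?_)
      · by_cases hA0 : A.natDegree = 0
        · rw [derivative_of_natDegree_zero hA0, mul_zero, natDegree_zero]; omega
        · have := natDegree_derivative_lt hA0
          exact natDegree_mul_le.trans (by omega)
      · have h1 : (derivative r).natDegree ≤ 2 * n :=
          (natDegree_derivative_le r).trans (by omega)
        have h2 : ((M : K[X]) * derivative r).natDegree ≤ 2 * n := by
          refine natDegree_mul_le.trans ?_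
          rw [natDegree_natCast]; omega
        exact natDegree_mul_le.trans (by omega)
    by_contra hne
    have hS0 : S ≠ 0 := by rintro rfl; exact hne (by rw [hS, mul_zero])
    rw [hsum, natDegree_neg, hS, ← mul_assoc, ← pow_succ,
      natDegree_mul (pow_ne_zero _ X_ne_zero) hS0, natDegree_X_pow] at hle
    omega
  have hdvd := pow_dvd_of_mul_derivative_eq hsep hMp (sub_eq_zero.1 hLQ)
  have hQz : Q = 0 := by
    by_contra hQne
    have h1 := natDegree_le_of_dvd hdvd hQne
    have h2 : Q.natDegree = H.natDegree - N := by
      rw [hQ, natDegree_divByMonic _ (monic_X_pow N), natDegree_X_pow]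
    have h3 : B.natDegree * p < n * p := Nat.mul_lt_mul_of_pos_right hBn hp.pos
    omega
  rw [hQz, mul_zero, add_zero] at hsplit
  rw [hsplit, hHd] at hAd
  have : N - 2 * n ≤ N := Nat.sub_le _ _
  omega

/-! ### Cartier vanishing implies separability -/

/-- The operator `h ↦ D ^ (p - 1) (h f ^ ((p - 1) / 2))` vanishes on polynomials of degree less
than `g`; this is the vanishing of the Cartier operator on the differentials `h dx / y` of
`y ^ 2 = f(x)`. -/
def CartierVanishes {K : Type*} [Field K] (p g : ℕ) (f : K[X]) : Prop :=
  ∀ h : K[X], h.degree < g → derivative^[p - 1] (h * f ^ ((p - 1) / 2)) = 0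

theorem iterate_derivative_comp_X_add_C {K : Type*} [Field K] (a : K) (k : ℕ) (F : K[X]) :
    derivative^[k] (F.comp (X + C a)) = (derivative^[k] F).comp (X + C a) := by
  induction k generalizing F with
  | zero => rfl
  | succ k ih => rw [Function.iterate_succ_apply, derivative_comp]; simp [ih]

theorem CartierVanishes.comp_X_add_C {K : Type*} [Field K] {p g : ℕ} {f : K[X]}
    (hf : CartierVanishes p g f) (a : K) : CartierVanishes p g (f.comp (X + C a)) := by
  intro h hh
  have h1 : (h.comp (X - C a)).degree < g := by
    rwa [sub_eq_add_neg, ← C_neg, ← taylor_apply, degree_taylor]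
  have h2 := congrArg (fun G => G.comp (X + C a)) (hf _ h1)
  simp only [← iterate_derivative_comp_X_add_C, mul_comp, pow_comp, comp_assoc, zero_comp] at h2
  simpa using h2

/-- X^p has derivative zero, so it acts as a constant. -/
theorem iterate_derivative_X_pow_char_mul {K : Type*} [Field K] (p : ℕ) [CharP K p] (k : ℕ)
    (F : K[X]) : derivative^[k] (X ^ p * F) = X ^ p * derivative^[k] F := by
  induction k generalizing F with
  | zero => rfl
  | succ k ih =>
    rw [Function.iterate_succ_apply, Function.iterate_succ_apply, derivative_mul,
      derivative_X_pow, CharP.cast_eq_zero, map_zero, zero_mul, zero_mul, zero_add, ih]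

/-- A polynomial of odd degree that splits, is not a power of a linear polynomial, and satisfies
the Cartier vanishing condition is separable. -/
theorem CartierVanishes.separable {K : Type*} [Field K] {p : ℕ} [Fact p.Prime] [CharP K p]
    (hp2 : p ≠ 2) {g : ℕ} {f : K[X]} (hf : CartierVanishes p g f) (hmon : f.Monic)
    (hdeg : f.natDegree = 2 * g + 1) (hs : f.Splits)
    (hne : ∀ a, f ≠ (X - C a) ^ (2 * g + 1)) : f.Separable := by
  have hp : p.Prime := Fact.out
  obtain ⟨M, hM⟩ : ∃ M, p = 2 * M + 1 := hp.odd_of_ne_two hp2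
  have hM2 : (p - 1) / 2 = M := by omega
  induction g generalizing f with
  | zero =>
    rw [hmon.eq_X_add_C (by simpa using hdeg)]
    exact separable_X_add_C _
  | succ n ih =>
    classical
    by_contra hsep
    rw [← nodup_roots_iff_of_splits hmon.ne_zero hs, Multiset.nodup_iff_count_le_one] at hsep
    push Not at hsep
    obtain ⟨a, ha⟩ := hsep
    rw [count_roots] at ha
    have hdvd : (X - C a) ^ 2 ∣ f := (le_rootMultiplicity_iff hmon.ne_zero).1 ha
    obtain ⟨q, hq⟩ := hdvd
    have hqm : q.Monic := ((monic_X_sub_C a).pow 2).of_mul_monic_left (hq ▸ hmon)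
    set r := q.comp (X + C a) with hr
    have hrm : r.Monic := hqm.comp_X_add_C a
    have hrd : r.natDegree = 2 * n + 1 := by
      rw [hr, natDegree_comp, natDegree_X_add_C, mul_one]
      rw [hq, ((monic_X_sub_C a).pow 2).natDegree_mul hqm, natDegree_pow, natDegree_X_sub_C]
        at hdeg
      omega
    have hrs : r.Splits := (hs.of_dvd hmon.ne_zero ⟨_, hq.trans (mul_comm _ _)⟩).comp_X_add_C a
    have hfr : f.comp (X + C a) = X ^ 2 * r := by rw [hq]; simp [hr]
    have hc := hf.comp_X_add_C a
    rw [hfr] at hc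
    have hpow : ∀ h : K[X], h * (X ^ 2 * r) ^ ((p - 1) / 2) = X ^ (p - 1) * (h * r ^ M) := by
      intro h
      rw [hM2, mul_pow, ← pow_mul, show p - 1 = 2 * M by omega]
      ring
    have hcr : CartierVanishes p n r := by
      intro h hh
      rw [hM2]
      have h1 : (X * h).degree < ((n + 1 : ℕ) : WithBot ℕ) := by
        by_cases h0 : h = 0
        · rw [h0, mul_zero, degree_zero]; exact WithBot.bot_lt_coe _
        · rw [← natDegree_lt_iff_degree_lt h0] at hh
          rw [← natDegree_lt_iff_degree_lt (mul_ne_zero X_ne_zero h0),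
            natDegree_mul X_ne_zero h0, natDegree_X]
          omega
      have h2 := hc _ h1
      rw [hpow, show X ^ (p - 1) * (X * h * r ^ M) = X ^ (p - 1 + 1) * (h * r ^ M) by ring,
        Nat.sub_add_cancel hp.one_le, iterate_derivative_X_pow_char_mul] at h2
      exact (mul_eq_zero.1 h2).resolve_left (pow_ne_zero _ X_ne_zero)
    have hco : ∀ l ≤ n, ∀ k, (X ^ l * r ^ ((p - 1) / 2)).coeff (k * p) = 0 := by
      intro l hl k
      have h1 : (X ^ l : K[X]).degree < ((n + 1 : ℕ) : WithBot ℕ) := by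
        rw [degree_X_pow]; exact_mod_cast Nat.lt_succ_of_le hl
      have h2 := (iterate_derivative_pred_char_eq_zero_iff _).1 (hc _ h1) k
      rwa [hpow, mul_comm, coeff_mul_X_pow, ← hM2] at h2
    have hr0 : r.coeff 0 = 0 := by
      have h1 := hco 0 n.zero_le 0
      rw [pow_zero, one_mul, zero_mul, coeff_zero_eq_eval_zero, eval_pow] at h1
      rw [coeff_zero_eq_eval_zero]
      exact pow_eq_zero_iff (by have := hp.two_le; omega) |>.1 h1
    have hrne : ∀ b, r ≠ (X - C b) ^ (2 * n + 1) := by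
      intro b hb
      have hb0 : b = 0 := by
        rw [hb, coeff_zero_eq_eval_zero] at hr0
        simpa using hr0
      apply hne a
      have h1 := congrArg (fun G => G.comp (X - C a)) hfr
      rw [hb, hb0] at h1
      simp only [comp_assoc] at h1
      simp only [add_comp, X_comp, C_comp, sub_add_cancel, comp_X, map_zero, sub_zero, mul_comp,
        pow_comp] at h1
      rw [h1]
      ring
    -- For n = 0, r would be X, making f the cube of a linear polynomial.
    have hn : 1 ≤ n := by
      by_contra! hn
      obtain rfl : n = 0 := by omega
      apply hrne 0
      have h1 := hrm.eq_X_add_C hrd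
      rw [hr0] at h1
      simpa using h1
    obtain ⟨l, hl, k, hk⟩ := exists_coeff_pow_ne_zero_of_separable hp2 hn hrm hrd
      (ih hcr hrm hrd hrs hrne) hr0
    exact hk (hco l hl k)

/-- `CartierVanishes` is the vanishing of the Cartier–Manin matrix. -/
theorem cartierVanishes_of_coeff_eq_zero {K : Type*} [Field K] {p : ℕ} [Fact p.Prime] [CharP K p]
    (hp2 : p ≠ 2) {g : ℕ} {f : K[X]} (hdeg : f.natDegree = 2 * g + 1)
    (h : ∀ i j : ℕ, 1 ≤ i → i ≤ g → 1 ≤ j → j ≤ g → j ≤ i * p →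
      (f ^ ((p - 1) / 2)).coeff (i * p - j) = 0) : CartierVanishes p g f := by
  have hp : p.Prime := Fact.out
  obtain ⟨M, hM⟩ : ∃ M, p = 2 * M + 1 := hp.odd_of_ne_two hp2
  have hM2 : (p - 1) / 2 = M := by omega
  intro q hq
  rw [iterate_derivative_pred_char_eq_zero_iff]
  intro k
  rw [hM2] at h ⊢
  rw [coeff_mul]
  refine Finset.sum_eq_zero fun x hx => ?_
  rw [Finset.HasAntidiagonal.mem_antidiagonal] at hx
  by_cases hxg : g ≤ x.1
  · rw [coeff_eq_zero_of_degree_lt (hq.trans_le (by exact_mod_cast hxg)), zero_mul]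
  · rw [show x.2 = (k + 1) * p - (x.1 + 1) by rw [add_mul, one_mul]; omega]
    have h1 : (k + 1) * p = k * p + p := by ring
    -- Rows beyond the matrix give degrees exceeding that of f^M.
    by_cases hk : k + 1 ≤ g
    · rw [h (k + 1) (x.1 + 1) (by omega) hk (by omega) (by omega) (by omega), mul_zero]
    · rw [coeff_eq_zero_of_natDegree_lt (p := f ^ M), mul_zero]
      have h2 : g * p ≤ k * p := Nat.mul_le_mul_right p (by omega)
      have h3 : g * p = 2 * g * M + g := by rw [hM]; ring
      have h4 : M * (2 * g + 1) = 2 * g * M + M := by ring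
      rw [natDegree_pow, hdeg]
      omega

/-! ### Nonsingularity of both charts -/

theorem isNonsingularPlaneCurve_doubleCoverPoly {K : Type*} [Field K] (h2 : (2 : K) ≠ 0)
    {f : K[X]} (hf : ∀ x : AlgebraicClosure K, aeval x f = 0 → aeval x (derivative f) ≠ 0) :
    IsNonsingularPlaneCurve (doubleCoverPoly f) := by
  intro P hP
  have hcomp : ∀ q : K[X], MvPolynomial.aeval P
      (aeval (MvPolynomial.X 0 : MvPolynomial (Fin 2) K) q) = aeval (P 0) q := by
    intro q
    rw [← aeval_algHom_apply, MvPolynomial.aeval_X]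
  simp only [doubleCoverPoly, map_sub, map_pow, MvPolynomial.aeval_X, hcomp] at hP
  by_cases hy : P 1 = 0
  · refine ⟨0, ?_⟩
    have h0 : aeval (P 0) f = 0 := by
      rw [hy] at hP; simpa using hP
    have hd : MvPolynomial.pderiv (0 : Fin 2)
        (aeval (MvPolynomial.X 0 : MvPolynomial (Fin 2) K) f)
        = aeval (MvPolynomial.X 0 : MvPolynomial (Fin 2) K) (derivative f) := by
      rw [Derivation.map_aeval, MvPolynomial.pderiv_X_self, smul_eq_mul, mul_one]
    rw [doubleCoverPoly, map_sub, hd, Derivation.leibniz_pow,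
      MvPolynomial.pderiv_X_of_ne (by decide)]
    simpa [hcomp] using hf _ h0
  · refine ⟨1, ?_⟩
    have hd : MvPolynomial.pderiv (1 : Fin 2)
        (aeval (MvPolynomial.X 0 : MvPolynomial (Fin 2) K) f) = 0 := by
      rw [Derivation.map_aeval, MvPolynomial.pderiv_X_of_ne (by decide), smul_zero]
    rw [doubleCoverPoly, map_sub, hd, Derivation.leibniz_pow, MvPolynomial.pderiv_X_self]
    have h2' : (2 : AlgebraicClosure K) ≠ 0 := by
      rw [← map_ofNat (algebraMap K (AlgebraicClosure K)) 2]
      exact (_root_.map_ne_zero _).2 h2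
    simpa [hy] using h2'

/-- X D multiplies degree k by k, and reflection exchanges k with N - k. -/
theorem X_mul_derivative_reflect {R : Type*} [CommRing R] {N : ℕ} {f : R[X]}
    (hf : f.natDegree ≤ N) :
    X * derivative (reflect N f) = (N : R[X]) * reflect N f - reflect N (X * derivative f) := by
  have hX : ∀ (q : R[X]) (k : ℕ), (X * derivative q).coeff k = k * q.coeff k := by
    intro q k
    cases k with
    | zero => simp
    | succ k => rw [coeff_X_mul, coeff_derivative]; push_cast; ring
  ext k
  rw [hX, coeff_sub, coeff_natCast_mul, coeff_reflect, coeff_reflect, hX]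
  by_cases hk : k ≤ N
  · rw [revAt_le hk, Nat.cast_sub hk]; ring
  · rw [revAt_eq_self_of_lt (by omega), coeff_eq_zero_of_natDegree_lt (by omega)]; ring

/-- At infinity, u = 0 is a simple zero since deg f is one less than 2g + 2; a multiple zero u ≠ 0
would make 1/u a multiple root of f. -/
theorem isNonsingularHyperelliptic_of_separable {K : Type*} [Field K] (h2 : (2 : K) ≠ 0) {g : ℕ}
    {f : K[X]} (hmon : f.Monic) (hdeg : f.natDegree = 2 * g + 1) (hf : f.Separable) :
    IsNonsingularHyperelliptic g f := by
  have hroot : ∀ x : AlgebraicClosure K, aeval x f = 0 → aeval x (derivative f) ≠ 0 :=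
    fun x hx => hf.aeval_derivative_ne_zero hx
  refine ⟨isNonsingularPlaneCurve_doubleCoverPoly h2 hroot,
    isNonsingularPlaneCurve_doubleCoverPoly h2 fun u hu => ?_⟩
  by_cases hu0 : u = 0
  · have h1 : (derivative (reflect (2 * g + 2) f)).coeff 0 = 1 := by
      rw [coeff_derivative, coeff_reflect, zero_add, revAt_le (by omega),
        show 2 * g + 2 - 1 = f.natDegree by omega, hmon.coeff_natDegree]
      simp
    rw [hu0, ← coeff_zero_eq_aeval_zero', h1]
    simp
  · intro hd
    have hrefl : ∀ q : K[X], q.natDegree ≤ 2 * g + 2 →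
        (aeval u (reflect (2 * g + 2) q) = 0 ↔ aeval u⁻¹ q = 0) := by
      intro q hq
      let : Invertible u⁻¹ := invertibleOfNonzero (inv_ne_zero hu0)
      have := eval₂_reflect_eq_zero_iff (algebraMap K (AlgebraicClosure K)) u⁻¹ (2 * g + 2) q hq
      rwa [invOf_eq_inv, inv_inv] at this
    have hfN : f.natDegree ≤ 2 * g + 2 := by omega
    have h1 := congrArg (aeval u) (X_mul_derivative_reflect hfN)
    rw [map_mul, hd, mul_zero, map_sub, map_mul, hu, mul_zero, zero_sub, eq_comm, neg_eq_zero,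
      hrefl _ (natDegree_mul_le.trans (by
        have := natDegree_derivative_le f
        have := natDegree_X_le (R := K)
        omega)), map_mul, aeval_X] at h1
    exact hroot u⁻¹ ((hrefl f hfN).1 hu)
      ((mul_eq_zero.1 h1).resolve_left (inv_ne_zero hu0))

/-! ### The Rosenhain polynomial and the conclusion -/

theorem monic_rosenhainPoly {R ι : Type*} [CommRing R] [Fintype ι] (z : ι → R) :
    (rosenhainPoly z).Monic :=
  (monic_X.mul (by simpa using monic_X_sub_C (1 : R))).mul
    (monic_prod_of_monic _ _ fun k _ => monic_X_sub_C (z k))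

theorem natDegree_rosenhainPoly {R ι : Type*} [CommRing R] [Nontrivial R] [Fintype ι] (z : ι → R) :
    (rosenhainPoly z).natDegree = 2 + Fintype.card ι := by
  have h1 : (X - 1 : R[X]).Monic := by simpa using monic_X_sub_C (1 : R)
  have h2 : (X - 1 : R[X]).natDegree = 1 := by simpa using natDegree_X_sub_C (1 : R)
  rw [rosenhainPoly, (monic_X.mul h1).natDegree_mul
    (monic_prod_of_monic _ _ fun k _ => monic_X_sub_C (z k)), monic_X.natDegree_mul h1,
    natDegree_X, h2, natDegree_prod_of_monic _ _ fun k _ => monic_X_sub_C (z k)]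
  simp

theorem map_rosenhainPoly {R S ι : Type*} [CommRing R] [CommRing S] [Fintype ι] (φ : R →+* S)
    (z : ι → R) : (rosenhainPoly z).map φ = rosenhainPoly fun k => φ (z k) := by
  simp [rosenhainPoly, Polynomial.map_prod]

theorem splits_rosenhainPoly {K ι : Type*} [Field K] [Fintype ι] (z : ι → K) :
    (rosenhainPoly z).Splits :=
  (Splits.X.mul (by simpa using Splits.X_sub_C (1 : K))).mul
    (Splits.prod fun k _ => Splits.X_sub_C (z k))

/-- The roots 0 and 1 are distinct; this rules out the exceptional case of
`CartierVanishes.separable`. -/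
theorem rosenhainPoly_ne_pow {K ι : Type*} [Field K] [Fintype ι] (z : ι → K) (a : K) (n : ℕ) :
    rosenhainPoly z ≠ (X - C a) ^ n := by
  intro h
  have h0 := congrArg (eval 0) h
  have h1 := congrArg (eval 1) h
  simp only [rosenhainPoly, eval_mul, eval_X, eval_sub, eval_one, eval_pow, eval_C, zero_mul,
    sub_self, mul_zero] at h0 h1
  have ha := eq_zero_of_pow_eq_zero h0.symm
  have hb := eq_zero_of_pow_eq_zero h1.symm
  rw [zero_sub, neg_eq_zero] at ha
  rw [ha, sub_zero] at hb
  exact one_ne_zero hb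

theorem aeval_cmCoeff (p g : ℕ) {K : Type*} [Field K] [Algebra (ZMod p) K]
    (lam : Fin (2 * g - 1) → K) (k : ℕ) :
    MvPolynomial.aeval lam (cmCoeff p g k) = (rosenhainPoly lam ^ ((p - 1) / 2)).coeff k := by
  have h := map_rosenhainPoly (MvPolynomial.aeval (R := ZMod p) lam).toRingHom
    (fun i : Fin (2 * g - 1) => (MvPolynomial.X i : MvPolynomial (Fin (2 * g - 1)) (ZMod p)))
  simp only [AlgHom.toRingHom_eq_coe, RingHom.coe_coe, MvPolynomial.aeval_X] at h
  rw [cmCoeff, if_pos (Int.natCast_nonneg k), Int.toNat_natCast, ← h, ← Polynomial.map_pow,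
    coeff_map, RingHom.coe_coe]

/-- The roots of a separable `rosenhainPoly` are pairwise distinct. -/
theorem distinct_of_separable_rosenhainPoly {K ι : Type*} [Field K] [Fintype ι] {z : ι → K}
    (h : (rosenhainPoly z).Separable) :
    (∀ k, z k ≠ 0) ∧ (∀ k, z k ≠ 1) ∧ ∀ k l, k ≠ l → z k ≠ z l := by
  have hc : IsCoprime (X * (X - 1)) (∏ k, (X - C (z k))) := h.isCoprime
  have hdvd : ∀ k, (X - C (z k)) ∣ ∏ k, (X - C (z k)) :=
    fun k => Finset.dvd_prod_of_mem _ (Finset.mem_univ k)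
  refine ⟨fun k hk => ?_, fun k hk => ?_, fun k l hkl => ?_⟩
  · exact not_isUnit_X_sub_C (z k) (hc.isUnit_of_dvd' (by rw [hk]; simp) (hdvd k))
  · exact not_isUnit_X_sub_C (z k) (hc.isUnit_of_dvd' (by rw [hk]; simp) (hdvd k))
  · exact (separable_prod_X_sub_C_iff.1 h.of_mul_right).ne hkl

theorem theoremB (p : ℕ) [Fact p.Prime] (hp : p ≠ 2) (g : ℕ) (hg : 1 ≤ g)
    {K : Type*} [Field K] [Algebra (ZMod p) K] (lam : Fin (2 * g - 1) → K)
    (hlam : ∀ i j : ℕ, 1 ≤ i → i ≤ g → 1 ≤ j → j ≤ g →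
      MvPolynomial.aeval lam (cmCoeff p g ((i : ℤ) * p - j)) = 0) :
    ((∀ k, lam k ≠ 0) ∧ (∀ k, lam k ≠ 1) ∧ (∀ k l, k ≠ l → lam k ≠ lam l)) ∧
      IsNonsingularHyperelliptic g (rosenhainPoly lam) := by
  have : CharP K p := charP_of_injective_algebraMap (algebraMap (ZMod p) K).injective p
  have h2 : (2 : K) ≠ 0 := Ring.two_ne_zero (by rwa [ringChar.eq K p])
  have hdeg : (rosenhainPoly lam).natDegree = 2 * g + 1 := by
    rw [natDegree_rosenhainPoly, Fintype.card_fin]; omega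
  have hsep : (rosenhainPoly lam).Separable := by
    refine CartierVanishes.separable hp (cartierVanishes_of_coeff_eq_zero hp hdeg ?_)
      (monic_rosenhainPoly lam) hdeg (splits_rosenhainPoly lam)
      fun a => rosenhainPoly_ne_pow lam a _
    intro i j hi hig hj hjg hij
    rw [← aeval_cmCoeff, Nat.cast_sub hij, Nat.cast_mul]
    exact hlam i j hi hig hj hjg
  exact ⟨distinct_of_separable_rosenhainPoly hsep,
    isNonsingularHyperelliptic_of_separable h2 (monic_rosenhainPoly lam) hdeg hsep⟩
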